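/- Let $1\le p<\infty$, let $X=\ell^p=\ell^p(\mathbb N)$ be the space of real $p$-summable sequences, and let $\sigma_1\ge\sigma_2\ge\dots>0$ satisfy $\sum_{j}\sigma_j^p<\infty$. Let $\mu=\bigotimes_{j}\mathcal N(0,\sigma_j^2)$ be the corresponding non-degenerate centred diagonal Gaussian measure on $X$, and let $E\subseteq X$ be its Cameron–Martin space, i.e. the set of $h\in X$ with $$|h|_E:=\sup\{|f(h)| : f\in X^\star,\ \|f\|_{L^2(\mu)}\le 1\}<\infty .$$ Write $B_\delta(x)$ for the open ball in $X$ with centre $x$ and radius $\delta$. Then $\mu(B_\delta(0))>0$ for every $\delta>0$, and the following hold. (1) For every family $(x^\delta)_{0<\delta<1}$ in $X$ and every $\bar z\in X\setminus E$ such that $x^\delta\rightharpoonup\bar z$ weakly in $X$ as $\delta\searrow0$, $$\limsup_{\delta\searrow0}\frac{\mu(B_\delta(x^\delta))}{\mu(B_\delta(0))}=0 .$$ (2) In particular, the vanishing condition for weak limits outside $E$ (condition (C3)) is satisfied: for every sequence $(\delta_m)_{m\in\mathbb N}$ of positive reals with $\delta_m\to0$ and every sequence $(x_m)_{m\in\mathbb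 N}$ in $X$ converging weakly to some $\bar z\notin E$, $$\liminf_{m\to\infty}\frac{\mu(B_{\delta_m}(x_m))}{\mu(B_{\delta_m}(0))}=0 .$$ -/

import Mathlib

open MeasureTheory ProbabilityTheory Filter Topology Metric
open scoped ENNReal NNReal

noncomputable section

/-- The sequence space `ℓ^p = ℓ^p(ℕ)` of real sequences, with its `p`-norm. -/
abbrev EllP (p : ℝ≥0∞) : Type := lp (fun _ : ℕ => ℝ) p

/-- `ℓ^p` carries its Borel σ-algebra. -/
instance EllP.instMeasurableSpace (p : ℝ≥0∞) [Fact (1 ≤ p)] : MeasurableSpace (EllP p) :=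
  borel (EllP p)

instance EllP.instBorelSpace (p : ℝ≥0∞) [Fact (1 ≤ p)] : BorelSpace (EllP p) := ⟨rfl⟩

/-- The diagonal Gaussian measure `⨂ⱼ N(0, σⱼ²)` on `ℓ^p`: the infinite product measure on `ℝ^ℕ`,
seen as a Borel measure on the subspace `ℓ^p`. -/
def diagonalGaussian (p : ℝ≥0∞) [Fact (1 ≤ p)] (σ : ℕ → ℝ) : Measure (EllP p) :=
  (Measure.infinitePi fun j : ℕ => gaussianReal 0 (σ j ^ 2).toNNReal).comap
    fun x : EllP p => (x : ℕ → ℝ)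

section General

variable {X : Type*} [NormedAddCommGroup X] [NormedSpace ℝ X] [MeasurableSpace X]

/-- The Cameron–Martin norm `|h|_E = sup {|f(h)| : f ∈ X*, ‖f‖_{L²(μ)} ≤ 1}` of a point `h ∈ X`
with respect to a centred Gaussian measure `μ` on `X`, with value `∞` allowed. -/
def cameronMartinNorm (μ : Measure X) (h : X) : ℝ≥0∞ :=
  ⨆ (f : StrongDual ℝ X) (_ : eLpNorm f 2 μ ≤ 1), ‖f h‖ₑ

/-- The Cameron–Martin space `E = {h ∈ X : |h|_E < ∞}` of a centred Gaussian measure on `X`. -/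
def cameronMartinSpace (μ : Measure X) : Set X :=
  {h | cameronMartinNorm μ h < ∞}

/-- The ratio of ball masses `μ(B_δ(w)) / μ(B_δ(z))`, for open balls. -/
def ballRatio (μ : Measure X) (w z : X) (δ : ℝ) : ℝ≥0∞ :=
  μ (ball w δ) / μ (ball z δ)

/-- Weak convergence `x_i ⇀ z` in `X` along a filter. -/
def WeaklyTendsto {ι : Type*} (x : ι → X) (l : Filter ι) (z : X) : Prop :=
  Tendsto (fun i => toWeakSpace ℝ X (x i)) l (𝓝 (toWeakSpace ℝ X z))

/-- The vanishing condition for weak limits outside `E`: for every null sequence `(δ_m)` of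
positive reals and every weakly convergent sequence `(x_m)` whose weak limit is not in the
Cameron–Martin space of `μ`, the ratios `μ(B_{δ_m}(x_m)) / μ(B_{δ_m}(0))` have `liminf` zero. -/
def VanishingOutsideCameronMartin (μ : Measure X) : Prop :=
  ∀ (δ : ℕ → ℝ) (x : ℕ → X) (z : X), (∀ m, 0 < δ m) → Tendsto δ atTop (𝓝 0) →
    WeaklyTendsto x atTop z → z ∉ cameronMartinSpace μ →
      liminf (fun m => ballRatio μ (x m) 0 (δ m)) atTop = 0

end General

end

/-! Moving one coordinate `x j` of the centre of a ball to zero multiplies its mass by a controlled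
factor. Slicing the product measure along that coordinate reduces this to shifting a symmetric
interval under a one-dimensional Gaussian: the shift never increases mass, and for intervals inside
`[-δ, δ]` it costs at least `exp (-(x j ^ 2 - 2 * δ * |x j|) / (2 * σ j ^ 2))`. Treating `n`
coordinates this way and comparing the remaining tail with the origin by Anderson's inequality gives
`ballRatio_diagonalGaussian_le`.

Weak convergence gives coordinatewise convergence, so for each fixed `n` the bound tends to `exp (-½
∑_{j<n} z j ^ 2 / σ j ^ 2)`. By `mem_cameronMartinSpace_of_sum_le` these sums are unbounded when `z`
is outside the Cameron–Martin space, so the limit can be made arbitrarily small. -/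

/-! ### Shifts of one-dimensional Gaussians -/

theorem gaussianPDF_zero_le_of_abs_le {v : ℝ≥0} {s t : ℝ} (h : |t| ≤ |s|) :
    gaussianPDF 0 v s ≤ gaussianPDF 0 v t := by
  simp only [gaussianPDF, gaussianPDFReal, sub_zero]
  have : t ^ 2 ≤ s ^ 2 := sq_le_sq.2 h
  gcongr

/-- After the common part `A ∩ S` is discarded, the reflection `t ↦ x - t` carries `A \ S` into `S \
A`, where the density is larger because `S` is an interval symmetric about zero. -/
theorem gaussianReal_preimage_sub_le {v : ℝ≥0} (hv : v ≠ 0) {S : Set ℝ} (hS : MeasurableSet S)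
    (hdown : ∀ s ∈ S, ∀ t, |t| ≤ |s| → t ∈ S) (x : ℝ) :
    gaussianReal 0 v {t | t - x ∈ S} ≤ gaussianReal 0 v S := by
  set A : Set ℝ := {t | t - x ∈ S} with hA
  have hAm : MeasurableSet A := hS.preimage (measurable_id.sub_const x)
  rw [← measure_inter_add_sdiff A hS, ← measure_inter_add_sdiff S hAm, Set.inter_comm S A]
  gcongr 1
  rw [gaussianReal_apply 0 hv, gaussianReal_apply 0 hv, ← lintegral_indicator (hAm.diff hS),
    ← lintegral_indicator (hS.diff hAm),
    ← lintegral_sub_left_eq_self ((S \ A).indicator (gaussianPDF 0 v)) x]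
  refine lintegral_mono fun t => ?_
  by_cases ht : t ∈ A \ S
  · have h1 : x - t ∈ S \ A := by
      refine ⟨hdown _ ht.1 _ (abs_sub_comm x t).le, fun h => ht.2 (hdown _ h _ ?_)⟩
      simp
    rw [Set.indicator_of_mem ht, Set.indicator_of_mem h1]
    refine gaussianPDF_zero_le_of_abs_le (le_of_lt (not_le.1 fun h => ht.2 (hdown _ h1.1 _ h)))
  · simp [Set.indicator_of_notMem ht]

theorem gaussianReal_preimage_sub_le_exp_mul {v : ℝ≥0} (hv : v ≠ 0) {S : Set ℝ}
    (hS : MeasurableSet S) {δ : ℝ} (hδ : ∀ s ∈ S, |s| ≤ δ) (x : ℝ) :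
    gaussianReal 0 v {t | t - x ∈ S} ≤
      ENNReal.ofReal (Real.exp (-(x ^ 2 - 2 * δ * |x|) / (2 * v))) * gaussianReal 0 v S := by
  have hAm : MeasurableSet {t | t - x ∈ S} := hS.preimage (measurable_id.sub_const x)
  rw [gaussianReal_apply 0 hv, gaussianReal_apply 0 hv, ← lintegral_indicator hAm,
    ← lintegral_indicator hS, ← lintegral_const_mul' _ _ ENNReal.ofReal_ne_top,
    ← lintegral_add_right_eq_self _ x]
  refine lintegral_mono fun t => ?_
  by_cases ht : t ∈ S
  · rw [Set.indicator_of_mem (by simpa using ht), Set.indicator_of_mem ht]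
    simp only [gaussianPDF, gaussianPDFReal, sub_zero]
    rw [← ENNReal.ofReal_mul (by positivity)]
    apply ENNReal.ofReal_le_ofReal
    -- Expanding `(t + x) ^ 2` leaves the cross term `2 * t * x`, which is at least `-2 * δ * |x|`
    -- on `S`.
    rw [mul_left_comm, ← Real.exp_add, ← add_div]
    have h1 : -(t * x) ≤ δ * |x| := by
      calc -(t * x) ≤ |t * x| := neg_le_abs _
        _ = |t| * |x| := abs_mul _ _
        _ ≤ δ * |x| := by gcongr; exact hδ t ht
    gcongr
    nlinarith
  · rw [Set.indicator_of_notMem (by simpa using ht)]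
    exact zero_le

/-! ### Slicing an infinite product along one coordinate -/

theorem measurable_prod_update {ι : Type*} [DecidableEq ι] {X : ι → Type*}
    [∀ i, MeasurableSpace (X i)] (j : ι) :
    Measurable fun q : (∀ i, X i) × X j => Function.update q.1 j q.2 := by
  refine measurable_pi_iff.2 fun i => ?_
  by_cases h : i = j
  · subst h; simpa using measurable_snd
  · simp only [Function.update_of_ne h]; fun_prop

/-- Resampling one coordinate independently does not change the law; it suffices to check this on
finite boxes. -/
theorem infinitePi_map_update {ι : Type*} [DecidableEq ι] {X : ι → Type*}
    [∀ i, MeasurableSpace (X i)] (μ : ∀ i, Measure (X i)) [∀ i, IsProbabilityMeasure (μ i)]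
    (j : ι) :
    ((Measure.infinitePi μ).prod (μ j)).map (fun q => Function.update q.1 j q.2) =
      Measure.infinitePi μ := by
  have hm := measurable_prod_update (X := X) j
  refine Measure.eq_infinitePi _ fun s t ht => ?_
  rw [Measure.map_apply hm (.pi s.countable_toSet fun _ _ => ht _)]
  by_cases hj : j ∈ s
  · have : (fun q : (∀ i, X i) × X j => Function.update q.1 j q.2) ⁻¹' (Set.pi s t) =
        (Set.pi (s.erase j : Finset ι) t) ×ˢ t j := by
      ext q
      simp only [Set.mem_preimage, Set.mem_pi, Set.mem_prod, Finset.mem_coe, Finset.mem_erase]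
      constructor
      · refine fun h => ⟨fun i hi => ?_, by simpa using h j hj⟩
        simpa [Function.update_of_ne hi.1] using h i hi.2
      · rintro ⟨h1, h2⟩ i hi
        by_cases h : i = j
        · subst h; simpa using h2
        · simpa [Function.update_of_ne h] using h1 i ⟨h, hi⟩
    rw [this, Measure.prod_prod, Measure.infinitePi_pi _ fun i _ => ht i,
      Finset.prod_erase_mul _ _ hj]
  · have : (fun q : (∀ i, X i) × X j => Function.update q.1 j q.2) ⁻¹' (Set.pi s t) =
        (Set.pi s t) ×ˢ Set.univ := by
      ext q
      simp only [Set.mem_preimage, Set.mem_pi, Set.mem_prod, Finset.mem_coe, Set.mem_univ, and_true]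
      refine forall₂_congr fun i hi => ?_
      rw [Function.update_of_ne (by rintro rfl; exact hj hi)]
    rw [this, Measure.prod_prod, Measure.infinitePi_pi _ fun i _ => ht i, measure_univ, mul_one]

theorem infinitePi_eq_lintegral_update {ι : Type*} [DecidableEq ι] {X : ι → Type*}
    [∀ i, MeasurableSpace (X i)] (μ : ∀ i, Measure (X i)) [∀ i, IsProbabilityMeasure (μ i)]
    (j : ι) {A : Set (∀ i, X i)} (hA : MeasurableSet A) :
    Measure.infinitePi μ A =
      ∫⁻ y, μ j {t | Function.update y j t ∈ A} ∂Measure.infinitePi μ := by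
  have hm := measurable_prod_update (X := X) j
  conv_lhs => rw [← infinitePi_map_update μ j]
  rw [Measure.map_apply hm hA, Measure.prod_apply (hm hA)]
  rfl

/-! ### Zeroing one coordinate of the centre -/

/-- The infinite product of centred Gaussian measures with standard deviations `σ j`. -/
noncomputable abbrev gaussianPi (σ : ℕ → ℝ) : Measure (ℕ → ℝ) :=
  Measure.infinitePi fun j : ℕ => gaussianReal 0 (σ j ^ 2).toNNReal

/-- The `r`-th power of the `ℓ^r` distance of two real sequences, with value `∞` allowed. -/
noncomputable def powDist (r : ℝ) (x y : ℕ → ℝ) : ℝ≥0∞ := ∑' i, ‖y i - x i‖ₑ ^ r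

theorem measurable_powDist (r : ℝ) (x : ℕ → ℝ) : Measurable (powDist r x) := by
  unfold powDist
  fun_prop

theorem powDist_update (r : ℝ) (x y : ℕ → ℝ) (j : ℕ) (t : ℝ) :
    powDist r x (Function.update y j t) =
      ‖t - x j‖ₑ ^ r + ∑' i, if i = j then 0 else ‖y i - x i‖ₑ ^ r := by
  unfold powDist
  rw [ENNReal.tsum_eq_add_tsum_ite j, Function.update_self]
  congr 1
  refine tsum_congr fun i => ?_
  split_ifs with h
  · rfl
  · rw [Function.update_of_ne h]

/-- With the other coordinates frozen, a ball is cut in the `j`-th direction in a symmetric interval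
shifted by `x j`, so a one-dimensional bound uniform over such intervals integrates to the ball. -/
theorem gaussianPi_powDist_lt_le_of_forall (σ : ℕ → ℝ) {r : ℝ} (hr : 0 < r) (x : ℕ → ℝ)
    (R : ℝ≥0∞) (j : ℕ) (c : ℝ≥0∞) (hc_top : c ≠ ∞)
    (hc : ∀ S : Set ℝ, MeasurableSet S → (∀ s ∈ S, ∀ t, |t| ≤ |s| → t ∈ S) →
      (∀ s ∈ S, ‖s‖ₑ ^ r < R) →
        gaussianReal 0 (σ j ^ 2).toNNReal {t | t - x j ∈ S} ≤
          c * gaussianReal 0 (σ j ^ 2).toNNReal S) :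
    gaussianPi σ {y | powDist r x y < R} ≤
      c * gaussianPi σ {y | powDist r (Function.update x j 0) y < R} := by
  rw [infinitePi_eq_lintegral_update _ j (measurableSet_lt (measurable_powDist r _) measurable_const),
    infinitePi_eq_lintegral_update _ j (measurableSet_lt (measurable_powDist r _) measurable_const)]
  refine le_trans (lintegral_mono fun y => ?_) (lintegral_const_mul' c _ hc_top).le
  simp only [Set.mem_ofPred_eq, powDist_update]
  set a := ∑' i, if i = j then 0 else ‖y i - x i‖ₑ ^ r with ha
  have ha' : (∑' i, if i = j then 0 else ‖y i - Function.update x j 0 i‖ₑ ^ r) = a := by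
    refine tsum_congr fun i => ?_
    split_ifs with h
    · rfl
    · rw [Function.update_of_ne h]
  rw [ha']
  simp only [Function.update_self, sub_zero]
  refine hc {t | ‖t‖ₑ ^ r + a < R} (measurableSet_lt (by fun_prop) measurable_const) ?_ ?_
  · intro s hs t hts
    rw [Set.mem_ofPred_eq] at hs ⊢
    refine lt_of_le_of_lt ?_ hs
    have : ‖t‖ₑ ≤ ‖s‖ₑ := enorm_le_iff_norm_le.2 hts
    gcongr
  · exact fun s hs => lt_of_le_of_lt le_self_add (Set.mem_ofPred_eq ▸ hs)

theorem gaussianPi_powDist_lt_update_le (σ : ℕ → ℝ) (hσ : ∀ j, 0 < σ j) {r : ℝ} (hr : 0 < r)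
    (x : ℕ → ℝ) (R : ℝ≥0∞) (j : ℕ) :
    gaussianPi σ {y | powDist r x y < R} ≤
      gaussianPi σ {y | powDist r (Function.update x j 0) y < R} := by
  have hv : (σ j ^ 2).toNNReal ≠ 0 := (Real.toNNReal_pos.2 (pow_pos (hσ j) 2)).ne'
  simpa using gaussianPi_powDist_lt_le_of_forall σ hr x R j 1 ENNReal.one_ne_top fun S hS hd _ => by
    simpa using gaussianReal_preimage_sub_le hv hS hd (x j)

theorem gaussianPi_powDist_lt_update_le_exp_mul (σ : ℕ → ℝ) (hσ : ∀ j, 0 < σ j) {r : ℝ}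
    (hr : 0 < r) (x : ℕ → ℝ) (δ : ℝ) (j : ℕ) :
    gaussianPi σ {y | powDist r x y < ENNReal.ofReal δ ^ r} ≤
      ENNReal.ofReal (Real.exp (-(x j ^ 2 - 2 * δ * |x j|) / (2 * σ j ^ 2))) *
        gaussianPi σ {y | powDist r (Function.update x j 0) y < ENNReal.ofReal δ ^ r} := by
  have hv : (σ j ^ 2).toNNReal ≠ 0 := (Real.toNNReal_pos.2 (pow_pos (hσ j) 2)).ne'
  refine gaussianPi_powDist_lt_le_of_forall σ hr x _ j _ ENNReal.ofReal_ne_top fun S hS hd hb => ?_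
  have := gaussianReal_preimage_sub_le_exp_mul hv hS (δ := δ) (fun s hs => ?_) (x j)
  · rwa [Real.coe_toNNReal _ (sq_nonneg _)] at this
  · have h := (ENNReal.rpow_lt_rpow_iff hr).1 (hb s hs)
    rw [Real.enorm_eq_ofReal_abs] at h
    exact ((ENNReal.ofReal_lt_ofReal_iff_of_nonneg (abs_nonneg s)).1 h).le

/-! ### Tails, balls in `ℓ^p` and Anderson's inequality -/

/-- The sequence `x` with its first `n` entries replaced by zero. -/
noncomputable def EllP.tail {p : ℝ≥0∞} (n : ℕ) (x : EllP p) : EllP p :=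
  x - ∑ i ∈ Finset.range n, lp.single p i (x i)

theorem EllP.tail_zero {p : ℝ≥0∞} (x : EllP p) : EllP.tail 0 x = x := by simp [EllP.tail]

theorem EllP.coe_tail {p : ℝ≥0∞} (n : ℕ) (x : EllP p) (j : ℕ) :
    EllP.tail n x j = if j < n then 0 else x j := by
  simp only [EllP.tail, lp.coeFn_sub, lp.coeFn_sum, Pi.sub_apply, Finset.sum_apply,
    lp.coeFn_single, Finset.sum_pi_single, Finset.mem_range]
  split_ifs <;> simp

theorem EllP.coe_tail_succ {p : ℝ≥0∞} (n : ℕ) (x : EllP p) :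
    (EllP.tail (n + 1) x : ℕ → ℝ) = Function.update (EllP.tail n x) n 0 := by
  ext j
  by_cases h : j = n
  · subst h; simp [EllP.coe_tail]
  · rw [Function.update_of_ne h, EllP.coe_tail, EllP.coe_tail]
    have : j < n + 1 ↔ j < n := by omega
    simp [this]

section EllP

variable {p : ℝ≥0∞} [Fact (1 ≤ p)]

theorem toReal_pos_of_fact (hp : p ≠ ∞) : 0 < p.toReal :=
  ENNReal.toReal_pos (zero_lt_one.trans_le Fact.out).ne' hp

theorem EllP.secondCountableTopology (hp : p ≠ ∞) : SecondCountableTopology (EllP p) := by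
  set B : Set (EllP p) := Set.range fun i => lp.single p i (1 : ℝ) with hB
  have hs : TopologicalSpace.IsSeparable (closure (Submodule.span ℝ B : Set (EllP p))) :=
    ((Set.countable_range _).isSeparable.span (R := ℝ)).closure
  have hu : closure (Submodule.span ℝ B : Set (EllP p)) = Set.univ := by
    refine Set.eq_univ_of_forall fun f => ?_
    refine mem_closure_of_tendsto (lp.hasSum_single hp f) (Eventually.of_forall fun s => ?_)
    refine Submodule.sum_mem _ fun i _ => ?_
    have : lp.single p i (f i) = (f i) • lp.single (E := fun _ : ℕ => ℝ) p i (1 : ℝ) := by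
      rw [← lp.single_smul]; simp
    rw [this]
    exact Submodule.smul_mem _ _ (Submodule.subset_span ⟨i, rfl⟩)
  rw [hu] at hs
  have := TopologicalSpace.isSeparable_univ_iff.1 hs
  exact UniformSpace.secondCountable_of_separable _

/-- An injective measurable map out of a Polish space is a measurable embedding; this makes the
`comap` in `diagonalGaussian` computable on balls. -/
theorem EllP.measurableEmbedding_coe (hp : p ≠ ∞) :
    MeasurableEmbedding fun x : EllP p => (x : ℕ → ℝ) := by
  have := EllP.secondCountableTopology hp
  refine Measurable.measurableEmbedding (measurable_pi_iff.2 fun i => ?_) Subtype.val_injective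
  exact (lp.lipschitzWith_one_eval p i).continuous.measurable

theorem powDist_coe (hp : p ≠ ∞) (x y : EllP p) :
    powDist p.toReal x y = ENNReal.ofReal (dist y x) ^ p.toReal := by
  have h0 := toReal_pos_of_fact hp
  rw [ENNReal.ofReal_rpow_of_nonneg dist_nonneg h0.le, dist_eq_norm, lp.norm_rpow_eq_tsum h0,
    ENNReal.ofReal_tsum_of_nonneg (fun _ => by positivity) ((lp.memℓp _).summable h0)]
  refine tsum_congr fun i => ?_
  rw [← ENNReal.ofReal_rpow_of_nonneg (norm_nonneg _) h0.le, ofReal_norm]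
  rfl

theorem memℓp_of_powDist_lt_top (hp : p ≠ ∞) (x : EllP p) {y : ℕ → ℝ}
    (hy : powDist p.toReal x y < ∞) : Memℓp y p := by
  have h0 := toReal_pos_of_fact hp
  have h : Memℓp (y - (x : ℕ → ℝ)) p := by
    refine memℓp_gen ?_
    have := ENNReal.summable_toReal hy.ne
    refine this.congr fun i => ?_
    rw [← ENNReal.toReal_rpow, toReal_enorm]
    rfl
  simpa using h.add (lp.memℓp x)

theorem EllP.image_coe_ball (hp : p ≠ ∞) (x : EllP p) (δ : ℝ) :
    (fun x : EllP p => (x : ℕ → ℝ)) '' ball x δ =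
      {y | powDist p.toReal x y < ENNReal.ofReal δ ^ p.toReal} := by
  have h0 := toReal_pos_of_fact hp
  have key (y : EllP p) : y ∈ ball x δ ↔ powDist p.toReal x y < ENNReal.ofReal δ ^ p.toReal := by
    rw [powDist_coe hp, ENNReal.rpow_lt_rpow_iff h0,
      ENNReal.ofReal_lt_ofReal_iff_of_nonneg dist_nonneg, mem_ball]
  ext y
  constructor
  · rintro ⟨y, hy, rfl⟩
    exact (key y).1 hy
  · exact fun hy => ⟨⟨y, memℓp_of_powDist_lt_top hp x (lt_of_lt_of_le hy le_top)⟩, (key _).2 hy, rfl⟩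

theorem diagonalGaussian_ball (hp : p ≠ ∞) (σ : ℕ → ℝ) (x : EllP p) (δ : ℝ) :
    diagonalGaussian p σ (ball x δ) =
      gaussianPi σ {y | powDist p.toReal x y < ENNReal.ofReal δ ^ p.toReal} := by
  rw [diagonalGaussian, (EllP.measurableEmbedding_coe hp).comap_apply, EllP.image_coe_ball hp]

theorem lintegral_enorm_rpow_gaussianReal_zero (σ : ℝ) (hσ : 0 ≤ σ) {r : ℝ} (hr : 0 ≤ r) :
    ∫⁻ t, ‖t‖ₑ ^ r ∂gaussianReal 0 (σ ^ 2).toNNReal =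
      ENNReal.ofReal (σ ^ r) * ∫⁻ t, ‖t‖ₑ ^ r ∂gaussianReal 0 1 := by
  have h : gaussianReal 0 (σ ^ 2).toNNReal = (gaussianReal 0 1).map (σ * ·) := by
    rw [gaussianReal_map_const_mul, mul_zero, mul_one]
    congr 1
    ext
    simp [sq_nonneg]
  rw [h, lintegral_map (by fun_prop) (by fun_prop), ← lintegral_const_mul' _ _ ENNReal.ofReal_ne_top]
  refine lintegral_congr fun t => ?_
  rw [enorm_mul, ENNReal.mul_rpow_of_nonneg _ _ hr, ← ENNReal.ofReal_rpow_of_nonneg hσ hr,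
    Real.enorm_eq_ofReal hσ]

/-- The expectation of `∑ |y i| ^ p` is a constant times `∑ σ i ^ p`, hence finite. -/
theorem gaussianPi_ae_memℓp (hp : p ≠ ∞) (σ : ℕ → ℝ) (hσ : ∀ j, 0 < σ j)
    (hsum : Summable fun j => σ j ^ p.toReal) : ∀ᵐ y ∂gaussianPi σ, Memℓp y p := by
  have h0 := toReal_pos_of_fact hp
  have hC : ∫⁻ t, ‖t‖ₑ ^ p.toReal ∂gaussianReal 0 1 ≠ ∞ :=
    (lintegral_rpow_enorm_lt_top_of_eLpNorm_lt_top (zero_lt_one.trans_le Fact.out).ne' hp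
      (memLp_id_gaussianReal' (μ := 0) (v := 1) p hp).2).ne
  have hint : ∫⁻ y, powDist p.toReal (0 : EllP p) y ∂gaussianPi σ ≠ ∞ := by
    unfold powDist
    rw [lintegral_tsum fun i =>
      (((measurable_pi_apply i).sub_const _).enorm.pow_const _).aemeasurable]
    have (i : ℕ) : ∫⁻ y, ‖y i - (0 : EllP p) i‖ₑ ^ p.toReal ∂gaussianPi σ =
        ENNReal.ofReal (σ i ^ p.toReal) * ∫⁻ t, ‖t‖ₑ ^ p.toReal ∂gaussianReal 0 1 := by
      rw [← lintegral_enorm_rpow_gaussianReal_zero _ (hσ i).le h0.le,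
        ← Measure.infinitePi_map_eval (fun j => gaussianReal 0 (σ j ^ 2).toNNReal) i,
        lintegral_map (by fun_prop) (by fun_prop)]
      simp
    simp_rw [this]
    rw [ENNReal.tsum_mul_right]
    exact ENNReal.mul_ne_top hsum.tsum_ofReal_ne_top hC
  filter_upwards [ae_lt_top (measurable_powDist _ _) hint] with y hy
  exact memℓp_of_powDist_lt_top hp 0 hy

theorem map_coe_diagonalGaussian (hp : p ≠ ∞) (σ : ℕ → ℝ) (hσ : ∀ j, 0 < σ j)
    (hsum : Summable fun j => σ j ^ p.toReal) :
    (diagonalGaussian p σ).map (fun x : EllP p => (x : ℕ → ℝ)) = gaussianPi σ := by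
  rw [diagonalGaussian, (EllP.measurableEmbedding_coe hp).map_comap]
  refine Measure.restrict_eq_self_of_ae_mem ?_
  filter_upwards [gaussianPi_ae_memℓp hp σ hσ hsum] with y hy
  exact ⟨⟨y, hy⟩, rfl⟩

theorem isProbabilityMeasure_diagonalGaussian (hp : p ≠ ∞) (σ : ℕ → ℝ) (hσ : ∀ j, 0 < σ j)
    (hsum : Summable fun j => σ j ^ p.toReal) : IsProbabilityMeasure (diagonalGaussian p σ) := by
  refine ⟨?_⟩
  have h := congrArg (· Set.univ) (map_coe_diagonalGaussian hp σ hσ hsum)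
  simpa [Measure.map_apply (EllP.measurableEmbedding_coe hp).measurable MeasurableSet.univ] using h

theorem EllP.tendsto_norm_tail (hp : p ≠ ∞) (x : EllP p) :
    Tendsto (fun n => ‖EllP.tail n x‖) atTop (𝓝 0) := by
  have h := (lp.hasSum_single hp x).tendsto_sum_nat.const_sub x
  rw [sub_self] at h
  exact tendsto_zero_iff_norm_tendsto_zero.1 h

theorem diagonalGaussian_ball_le_ball_tail (hp : p ≠ ∞) (σ : ℕ → ℝ) (hσ : ∀ j, 0 < σ j)
    (x : EllP p) (δ : ℝ) (n : ℕ) :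
    diagonalGaussian p σ (ball x δ) ≤ diagonalGaussian p σ (ball (EllP.tail n x) δ) := by
  induction n with
  | zero => rw [EllP.tail_zero]
  | succ n ih =>
    refine ih.trans ?_
    rw [diagonalGaussian_ball hp, diagonalGaussian_ball hp, EllP.coe_tail_succ]
    exact gaussianPi_powDist_lt_update_le σ hσ (toReal_pos_of_fact hp) _ _ n

theorem diagonalGaussian_ball_le_prod_exp_mul_ball_tail (hp : p ≠ ∞) (σ : ℕ → ℝ)
    (hσ : ∀ j, 0 < σ j) (x : EllP p) (δ : ℝ) (n : ℕ) :
    diagonalGaussian p σ (ball x δ) ≤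
      ENNReal.ofReal (Real.exp
        (∑ j ∈ Finset.range n, -(x j ^ 2 - 2 * δ * |x j|) / (2 * σ j ^ 2))) *
        diagonalGaussian p σ (ball (EllP.tail n x) δ) := by
  induction n with
  | zero => simp [EllP.tail_zero]
  | succ n ih =>
    refine ih.trans ?_
    rw [Finset.sum_range_succ, Real.exp_add, ENNReal.ofReal_mul (Real.exp_nonneg _), mul_assoc]
    gcongr
    rw [diagonalGaussian_ball hp, diagonalGaussian_ball hp, EllP.coe_tail_succ]
    have := gaussianPi_powDist_lt_update_le_exp_mul σ hσ (toReal_pos_of_fact hp)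
      (EllP.tail n x) δ n
    rwa [EllP.coe_tail, if_neg (lt_irrefl n)] at this

/-- Anderson's inequality for balls. -/
theorem diagonalGaussian_ball_le_ball_zero (hp : p ≠ ∞) (σ : ℕ → ℝ) (hσ : ∀ j, 0 < σ j)
    (x : EllP p) (δ : ℝ) :
    diagonalGaussian p σ (ball x δ) ≤ diagonalGaussian p σ (ball 0 δ) := by
  -- Only finitely many coordinates can be zeroed, so a nonzero tail remains; the slack `δ - ε`
  -- absorbs its norm. Exhausting the open ball by smaller radii then removes the slack.
  have key (ε : ℝ) (hε : ε < δ) :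
      diagonalGaussian p σ (ball x ε) ≤ diagonalGaussian p σ (ball 0 δ) := by
    obtain ⟨n, hn⟩ := ((EllP.tendsto_norm_tail hp x).eventually
      (gt_mem_nhds (sub_pos.2 hε))).exists
    refine (diagonalGaussian_ball_le_ball_tail hp σ hσ x ε n).trans (measure_mono ?_)
    refine ball_subset_ball' ?_
    rw [dist_zero_right]
    linarith
  obtain ⟨u, hu, hlt, hlim⟩ := exists_seq_strictMono_tendsto δ
  have hU : ball x δ = ⋃ k, ball x (u k) := by
    ext y
    simp only [mem_ball, Set.mem_iUnion]
    exact ⟨fun h => (hlim.eventually (lt_mem_nhds h)).exists, fun ⟨k, hk⟩ => hk.trans (hlt k)⟩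
  rw [hU, Monotone.measure_iUnion fun i j hij => ball_subset_ball (hu.monotone hij)]
  exact iSup_le fun k => key _ (hlt k)

/-- If this ball were null, Anderson's inequality would make every ball of radius `δ` null, and
countably many of them cover the space. -/
theorem diagonalGaussian_ball_zero_pos (hp : p ≠ ∞) (σ : ℕ → ℝ) (hσ : ∀ j, 0 < σ j)
    (hsum : Summable fun j => σ j ^ p.toReal) {δ : ℝ} (hδ : 0 < δ) :
    0 < diagonalGaussian p σ (ball 0 δ) := by
  have := EllP.secondCountableTopology (p := p) hp
  have := isProbabilityMeasure_diagonalGaussian hp σ hσ hsum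
  by_contra! h
  have hz : diagonalGaussian p σ (⋃ k, ball (TopologicalSpace.denseSeq (EllP p) k) δ) = 0 :=
    measure_iUnion_null fun k =>
      le_antisymm ((diagonalGaussian_ball_le_ball_zero hp σ hσ _ δ).trans h) zero_le
  have hU : (⋃ k, ball (TopologicalSpace.denseSeq (EllP p) k) δ) = Set.univ := by
    refine Set.eq_univ_of_forall fun y => ?_
    obtain ⟨k, hk⟩ := (TopologicalSpace.denseRange_denseSeq (EllP p)).exists_dist_lt y hδ
    exact Set.mem_iUnion.2 ⟨k, hk⟩
  rw [hU, measure_univ] at hz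
  exact one_ne_zero hz

theorem ballRatio_diagonalGaussian_le (hp : p ≠ ∞) (σ : ℕ → ℝ) (hσ : ∀ j, 0 < σ j)
    (x : EllP p) (δ : ℝ) (n : ℕ) :
    ballRatio (diagonalGaussian p σ) x 0 δ ≤ ENNReal.ofReal (Real.exp
      (∑ j ∈ Finset.range n, -(x j ^ 2 - 2 * δ * |x j|) / (2 * σ j ^ 2))) := by
  refine ENNReal.div_le_of_le_mul
    ((diagonalGaussian_ball_le_prod_exp_mul_ball_tail hp σ hσ x δ n).trans ?_)
  exact mul_le_mul_right (diagonalGaussian_ball_le_ball_zero hp σ hσ _ δ) _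

end EllP

/-! ### Cameron–Martin space and the vanishing limit -/

section CameronMartin

variable {p : ℝ≥0∞} [Fact (1 ≤ p)]

theorem gaussianPi_map_reflect (σ : ℕ → ℝ) (n : ℕ) :
    (gaussianPi σ).map (fun y i => if i < n then -y i else y i) = gaussianPi σ := by
  have h := Measure.infinitePi_map_pi (fun j : ℕ => gaussianReal 0 (σ j ^ 2).toNNReal)
    (f := fun i t => if i < n then -t else t) (fun i => by split_ifs <;> fun_prop)
  rw [h]
  congr 1
  ext1 i
  split_ifs
  · rw [gaussianReal_map_neg, neg_zero]
  · exact Measure.map_id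

/-- The isometry of `ℓ^p` that changes the sign of the first `n` entries. -/
noncomputable def EllP.reflect {p : ℝ≥0∞} (n : ℕ) (x : EllP p) : EllP p :=
  x - (2 : ℝ) • ∑ i ∈ Finset.range n, lp.single p i (x i)

theorem EllP.coe_reflect {p : ℝ≥0∞} (n : ℕ) (x : EllP p) (j : ℕ) :
    EllP.reflect n x j = if j < n then -x j else x j := by
  simp only [EllP.reflect, lp.coeFn_sub, lp.coeFn_sum, Pi.sub_apply, Finset.sum_apply,
    lp.coeFn_smul, Pi.smul_apply, lp.coeFn_single, Finset.sum_pi_single, Finset.mem_range]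
  split_ifs
  · simp; ring
  · simp

theorem EllP.continuous_reflect (n : ℕ) : Continuous (EllP.reflect (p := p) n) := by
  refine continuous_id.sub ((continuous_finsetSum _ fun i _ => ?_).const_smul (2 : ℝ))
  exact (lp.isometry_single (E := fun _ : ℕ => ℝ) i).continuous.comp
    (lp.lipschitzWith_one_eval p i).continuous

theorem measurePreserving_reflect_diagonalGaussian (hp : p ≠ ∞) (σ : ℕ → ℝ) (hσ : ∀ j, 0 < σ j)
    (hsum : Summable fun j => σ j ^ p.toReal) (n : ℕ) :
    MeasurePreserving (EllP.reflect n) (diagonalGaussian p σ) (diagonalGaussian p σ) := by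
  have he := EllP.measurableEmbedding_coe (p := p) hp
  have hm := (EllP.continuous_reflect (p := p) n).measurable
  refine ⟨hm, ?_⟩
  have h : (((diagonalGaussian p σ).map (EllP.reflect n)).map fun x : EllP p => (x : ℕ → ℝ)) =
      (diagonalGaussian p σ).map fun x : EllP p => (x : ℕ → ℝ) := by
    rw [Measure.map_map he.measurable hm]
    have hc : (fun x : EllP p => (x : ℕ → ℝ)) ∘ EllP.reflect n =
        (fun y i => if i < n then -y i else y i) ∘ fun x : EllP p => (x : ℕ → ℝ) := by
      ext x j
      exact EllP.coe_reflect n x j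
    rw [hc, ← Measure.map_map _ he.measurable, map_coe_diagonalGaussian hp σ hσ hsum,
      gaussianPi_map_reflect]
    exact measurable_pi_iff.2 fun i => by split_ifs <;> fun_prop
  -- A measure on `ℓ^p` is recovered from its image in `ℝ^ℕ`.
  rw [← he.comap_map ((diagonalGaussian p σ).map (EllP.reflect n)), h, he.comap_map]

/-- The coordinates are independent and centred, so second moments add. -/
theorem eLpNorm_two_sum_mul_gaussianPi_sq (σ : ℕ → ℝ) (a : ℕ → ℝ) (n : ℕ) :
    eLpNorm (fun y : ℕ → ℝ => ∑ i ∈ Finset.range n, a i * y i) 2 (gaussianPi σ) ^ 2 =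
      ENNReal.ofReal (∑ i ∈ Finset.range n, a i ^ 2 * σ i ^ 2) := by
  have hlaw (i : ℕ) : HasLaw (fun y : ℕ → ℝ => a i * y i)
      (gaussianReal (a i * 0) (.mk (a i ^ 2) (sq_nonneg _) * (σ i ^ 2).toNNReal)) (gaussianPi σ) :=
    gaussianReal_const_mul (X := fun y : ℕ → ℝ => y i)
      (measurePreserving_eval_infinitePi
        (fun j => gaussianReal 0 (σ j ^ 2).toNNReal) i).hasLaw (a i)
  have hmem (i : ℕ) : MemLp (fun y : ℕ → ℝ => a i * y i) 2 (gaussianPi σ) := by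
    have := (memLp_id_gaussianReal' (μ := a i * 0)
      (v := .mk (a i ^ 2) (sq_nonneg _) * (σ i ^ 2).toNNReal) 2 (by simp))
    rw [← (hlaw i).map_eq] at this
    exact this.comp_of_map (hlaw i).aemeasurable
  have hmean (i : ℕ) : ∫ y, a i * y i ∂gaussianPi σ = 0 := by
    rw [(hlaw i).integral_eq, integral_id_gaussianReal, mul_zero]
  have hvar (i : ℕ) : Var[fun y : ℕ → ℝ => a i * y i; gaussianPi σ] = a i ^ 2 * σ i ^ 2 := by
    rw [(hlaw i).variance_eq, variance_id_gaussianReal, NNReal.coe_mul,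
      Real.coe_toNNReal _ (sq_nonneg _)]
    rfl
  have hind : iIndepFun (fun i (y : ℕ → ℝ) => a i * y i) (gaussianPi σ) :=
    iIndepFun_infinitePi (P := fun j => gaussianReal 0 (σ j ^ 2).toNNReal)
      (X := fun i t => a i * t) (fun i => by fun_prop)
  have hS : MemLp (∑ i ∈ Finset.range n, fun y : ℕ → ℝ => a i * y i) 2 (gaussianPi σ) :=
    memLp_finsetSum' _ fun i _ => hmem i
  have hV := IndepFun.variance_sum (s := Finset.range n) (fun i _ => hmem i)
    (fun i _ j _ hij => hind.indepFun hij)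
  simp only [hvar] at hV
  rw [variance_of_integral_eq_zero hS.1.aemeasurable ?_] at hV
  · have h2 := eLpNorm_nnreal_pow_eq_lintegral (p := 2)
      (f := fun y : ℕ → ℝ => ∑ i ∈ Finset.range n, a i * y i) (μ := gaussianPi σ) two_ne_zero
    simp only [NNReal.coe_ofNat, ENNReal.coe_ofNat, ENNReal.rpow_ofNat] at h2
    rw [← hV, h2, ofReal_integral_eq_lintegral_ofReal hS.integrable_sq
      (Eventually.of_forall fun _ => sq_nonneg _)]
    refine lintegral_congr fun y => ?_
    simp only [Finset.sum_apply]
    rw [← enorm_pow, Real.enorm_eq_ofReal (sq_nonneg _)]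
  · simp only [Finset.sum_apply]
    rw [integral_finsetSum _ fun i _ => (hmem i).integrable (by norm_num)]
    simp [hmean]

/-- The part `g` of `f` that sees only the first `n` coordinates is `(f - f ∘ EllP.reflect n) / 2`.
Since the reflection preserves the measure, the triangle inequality bounds the `L²` norm of `g` by
that of `f`. -/
theorem sum_sq_mul_sq_le_one (hp : p ≠ ∞) (σ : ℕ → ℝ) (hσ : ∀ j, 0 < σ j)
    (hsum : Summable fun j => σ j ^ p.toReal) (f : StrongDual ℝ (EllP p))
    (hf : eLpNorm f 2 (diagonalGaussian p σ) ≤ 1) (n : ℕ) :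
    ∑ i ∈ Finset.range n, f (lp.single p i 1) ^ 2 * σ i ^ 2 ≤ 1 := by
  have := EllP.secondCountableTopology (p := p) hp
  set μ := diagonalGaussian p σ
  set g : EllP p → ℝ := fun x => ∑ i ∈ Finset.range n, f (lp.single p i 1) * x i with hg
  have hmp := measurePreserving_reflect_diagonalGaussian hp σ hσ hsum n
  have hfm : AEStronglyMeasurable f μ := f.continuous.aestronglyMeasurable
  have hcomp : g = (2⁻¹ : ℝ) • (⇑f - ⇑f ∘ EllP.reflect n) := by
    ext x
    simp only [hg, Pi.smul_apply, Pi.sub_apply, Function.comp_apply, EllP.reflect, map_sub,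
      map_smul, map_sum, smul_eq_mul]
    rw [sub_sub_cancel, inv_mul_cancel_left₀ two_ne_zero]
    refine Finset.sum_congr rfl fun i _ => ?_
    have : lp.single p i (x i) = (x i) • lp.single (E := fun _ : ℕ => ℝ) p i (1 : ℝ) := by
      rw [← lp.single_smul]; simp
    rw [this, map_smul, smul_eq_mul, mul_comm]
  have hgle : eLpNorm g 2 μ ≤ 1 := by
    rw [hcomp, eLpNorm_const_smul]
    have h1 : eLpNorm (⇑f - ⇑f ∘ EllP.reflect n) 2 μ ≤ 1 + 1 := by
      refine (eLpNorm_sub_le hfm (hfm.comp_measurePreserving hmp) (by norm_num)).trans ?_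
      rw [eLpNorm_comp_measurePreserving hfm hmp]
      gcongr
    calc ‖(2⁻¹ : ℝ)‖ₑ * eLpNorm (⇑f - ⇑f ∘ EllP.reflect n) 2 μ
        ≤ ‖(2⁻¹ : ℝ)‖ₑ * (1 + 1) := by gcongr
      _ = 1 := by
        rw [Real.enorm_eq_ofReal (by norm_num), ENNReal.ofReal_inv_of_pos two_pos, one_add_one_eq_two]
        simpa using ENNReal.inv_mul_cancel (a := 2) (by simp) (by simp)
  have hsq := eLpNorm_two_sum_mul_gaussianPi_sq σ (fun i => f (lp.single p i 1)) n
  rw [← map_coe_diagonalGaussian hp σ hσ hsum, eLpNorm_map_measure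
    (Measurable.aestronglyMeasurable (by fun_prop))
    (EllP.measurableEmbedding_coe hp).measurable.aemeasurable] at hsq
  have h2 : ENNReal.ofReal (∑ i ∈ Finset.range n, f (lp.single p i 1) ^ 2 * σ i ^ 2) ≤ 1 := by
    rw [← hsq]
    exact pow_le_one' hgle 2
  exact ENNReal.ofReal_le_one.1 h2

/-- Cauchy–Schwarz applied to `∑ (z i / σ i) * (f e_i * σ i)`, with `e_i` the unit vectors, bounds
`|f z|` by `√C`. -/
theorem mem_cameronMartinSpace_of_sum_le (hp : p ≠ ∞) (σ : ℕ → ℝ) (hσ : ∀ j, 0 < σ j)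
    (hsum : Summable fun j => σ j ^ p.toReal) (z : EllP p) (C : ℝ)
    (hC : ∀ n, ∑ j ∈ Finset.range n, z j ^ 2 / σ j ^ 2 ≤ C) :
    z ∈ cameronMartinSpace (diagonalGaussian p σ) := by
  refine lt_of_le_of_lt (iSup₂_le fun f hf => ?_) (ENNReal.ofReal_lt_top (r := √C))
  rw [Real.enorm_eq_ofReal_abs]
  refine ENNReal.ofReal_le_ofReal ?_
  have hlim : Tendsto (fun n => |∑ i ∈ Finset.range n, f (lp.single p i (z i))|) atTop
      (𝓝 |f z|) := by
    simpa only [Function.comp_def, map_sum] using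
      ((f.continuous.tendsto z).comp (lp.hasSum_single hp z).tendsto_sum_nat).abs
  refine le_of_tendsto hlim (Eventually.of_forall fun n => Real.abs_le_sqrt ?_)
  have h1 : ∑ i ∈ Finset.range n, f (lp.single p i (z i)) =
      ∑ i ∈ Finset.range n, (z i / σ i) * (f (lp.single p i 1) * σ i) := by
    refine Finset.sum_congr rfl fun i _ => ?_
    have : lp.single p i (z i) = (z i) • lp.single (E := fun _ : ℕ => ℝ) p i (1 : ℝ) := by
      rw [← lp.single_smul]; simp
    rw [this, map_smul, smul_eq_mul]
    field_simp [(hσ i).ne']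
  rw [h1]
  refine (Finset.sum_mul_sq_le_sq_mul_sq _ _ _).trans ?_
  simp only [div_pow, mul_pow]
  calc _ ≤ (∑ j ∈ Finset.range n, z j ^ 2 / σ j ^ 2) * 1 := by
        gcongr
        exact sum_sq_mul_sq_le_one hp σ hσ hsum f hf n
    _ ≤ C := by simpa using hC n

/-- An arbitrary filter covers both the family indexed by `δ` and the sequential condition. -/
theorem tendsto_ballRatio_diagonalGaussian (hp : p ≠ ∞) (σ : ℕ → ℝ) (hσ : ∀ j, 0 < σ j)
    (hsum : Summable fun j => σ j ^ p.toReal) {ι : Type*} {l : Filter ι} {x : ι → EllP p}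
    {δ : ι → ℝ} {z : EllP p} (hδ : Tendsto δ l (𝓝 0)) (hx : WeaklyTendsto x l z)
    (hz : z ∉ cameronMartinSpace (diagonalGaussian p σ)) :
    Tendsto (fun i => ballRatio (diagonalGaussian p σ) (x i) 0 (δ i)) l (𝓝 0) := by
  have hcoord (j : ℕ) : Tendsto (fun i => x i j) l (𝓝 (z j)) :=
    ((WeakBilin.eval_continuous (topDualPairing ℝ (EllP p)).flip
      (lp.evalCLM ℝ (fun _ : ℕ => ℝ) p j)).tendsto _).comp hx
  rw [ENNReal.tendsto_nhds_zero]
  intro ε hε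
  -- The literal `0` is the limit of `δ`. If no such `n` existed, any positive real `c < ε` would
  -- bound all the sums by `-2 * log c`, placing `z` in the Cameron–Martin space.
  obtain ⟨n, hn⟩ : ∃ n, ENNReal.ofReal (Real.exp
      (∑ j ∈ Finset.range n, -(z j ^ 2 - 2 * 0 * |z j|) / (2 * σ j ^ 2))) < ε := by
    by_contra! h
    obtain ⟨c, hc, hcε⟩ := ENNReal.lt_iff_exists_nnreal_btwn.1 hε
    have hc' : 0 < (c : ℝ) := by exact_mod_cast hc
    refine hz (mem_cameronMartinSpace_of_sum_le hp σ hσ hsum z (-2 * Real.log c) fun n => ?_)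
    have h1 := hcε.le.trans (h n)
    rw [← ENNReal.ofReal_coe_nnreal, ENNReal.ofReal_le_ofReal_iff (Real.exp_nonneg _),
      ← Real.log_le_iff_le_exp hc'] at h1
    have h2 : ∑ j ∈ Finset.range n, -(z j ^ 2 - 2 * 0 * |z j|) / (2 * σ j ^ 2) =
        -(1 / 2) * ∑ j ∈ Finset.range n, z j ^ 2 / σ j ^ 2 := by
      rw [Finset.mul_sum]
      refine Finset.sum_congr rfl fun j _ => ?_
      have := (hσ j).ne'
      field_simp
      ring
    rw [h2] at h1
    linarith
  have hlim : Tendsto (fun i => ENNReal.ofReal (Real.exp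
      (∑ j ∈ Finset.range n, -(x i j ^ 2 - 2 * δ i * |x i j|) / (2 * σ j ^ 2)))) l
      (𝓝 (ENNReal.ofReal (Real.exp
        (∑ j ∈ Finset.range n, -(z j ^ 2 - 2 * 0 * |z j|) / (2 * σ j ^ 2))))) := by
    refine ENNReal.tendsto_ofReal ((Real.continuous_exp.tendsto _).comp
      (tendsto_finsetSum _ fun j _ => ?_))
    exact ((((hcoord j).pow 2).sub ((hδ.const_mul 2).mul (hcoord j).abs)).neg).div_const _
  filter_upwards [hlim.eventually (gt_mem_nhds hn)] with i hi
  exact (ballRatio_diagonalGaussian_le hp σ hσ (x i) (δ i) n).trans hi.le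

end CameronMartin

theorem mainTheorem6 (p : ℝ≥0∞) [Fact (1 ≤ p)] (hp : p ≠ ∞)
    (σ : ℕ → ℝ) (hσ_pos : ∀ j, 0 < σ j) (hσ_anti : Antitone σ)
    (hσ_sum : Summable fun j => σ j ^ p.toReal) :
    (∀ δ : ℝ, 0 < δ → 0 < diagonalGaussian p σ (ball 0 δ)) ∧
    (∀ (x : ℝ → EllP p) (z : EllP p), z ∉ cameronMartinSpace (diagonalGaussian p σ) →
      WeaklyTendsto x (𝓝[>] 0) z →
        limsup (fun δ => ballRatio (diagonalGaussian p σ) (x δ) 0 δ) (𝓝[>] 0) = 0) ∧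
    VanishingOutsideCameronMartin (diagonalGaussian p σ) := by
  refine ⟨fun δ hδ => diagonalGaussian_ball_zero_pos hp σ hσ_pos hσ_sum hδ, fun x z hz hx => ?_,
    fun δ x z _ hδ hx hz => ?_⟩
  · exact (tendsto_ballRatio_diagonalGaussian hp σ hσ_pos hσ_sum
      (tendsto_id.mono_left nhdsWithin_le_nhds) hx hz).limsup_eq
  · exact (tendsto_ballRatio_diagonalGaussian hp σ hσ_pos hσ_sum hδ hx hz).liminf_eq
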